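/- Let $G$ be a finitely generated group with a finite symmetric generating set $\Sigma$, and let $|g|$ denote the length of a shortest word over $\Sigma$ representing $g\in G$. Elements $g,h\in G$ are commensurable if $g^x=h^y$ for some $x,y\in\mathbb{Z}\setminus\{0\}$. The group $G$ is c-tame if there exist $d,C\in\mathbb{N}$ such that for all commensurable elements $g,h\in G$ of infinite order there are $s,t\in\mathbb{Z}\setminus\{0\}$ with $g^s=h^t$ and $|s|,|t|\le C\,(|g|+|h|)^d$. (This property does not depend on the choice of $\Sigma$; here it is asserted for every finite symmetric generating set $\Sigma$, with $d$ and $C$ allowed to depend on $G$ and $\Sigma$.) For $r\ge 1$ define the iterated restricted wreath products $W_{0,r}=\mathbb{Z}^r$ and $W_{m+1,r}=\mathbb{Z}^r\wr W_{m,r}$, and let $S_{m,r}=F_r/F_r^{(m)}$ be the free solvable group of derived length $m$ and rank $r$, where $F_r$ is the free group of rank $r$ and $F_r^{(0)}=F_r$, $F_r^{(i+1)}=[F_r^{(i)},F_r^{(i)}]$. Proposition. For all $r\ge 1$ and $m\ge 0$, the groups $W_{m,r}$ and $S_{m,r}$ are finitely generated and c-tame. -/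

import Mathlib

namespace CTameness

/-- The length `|g|` of a shortest word over `Γ` (a list of elements of `Γ`) whose product is `g`.
It is only used for sets `Γ` over which every element of the group can be written as a word. -/
noncomputable def wordLength {G : Type*} [Group G] (Γ : Set G) (g : G) : ℕ :=
  sInf {n : ℕ | ∃ w : List G, (∀ a ∈ w, a ∈ Γ) ∧ w.prod = g ∧ w.length = n}

/-- `Γ` is a finite symmetric generating set of `G`: finite, closed under inverses, and every
element of `G` is a product of elements of `Γ`. -/
structure IsFiniteSymmGenSet {G : Type*} [Group G] (Γ : Set G) : Prop where
  finite : Γ.Finite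
  symm : ∀ a ∈ Γ, a⁻¹ ∈ Γ
  generates : ∀ g : G, ∃ w : List G, (∀ a ∈ w, a ∈ Γ) ∧ w.prod = g

/-- `g` and `h` are commensurable: some nonzero powers of them agree. -/
def CommensurableElements {G : Type*} [Group G] (g h : G) : Prop :=
  ∃ x y : ℤ, x ≠ 0 ∧ y ≠ 0 ∧ g ^ x = h ^ y

/-- `G = ⟨Γ⟩` is tame with respect to commensurability, with lengths measured over `Γ`.
The constant `C` is the one hidden in the `O`-notation. -/
def IsCTameWith {G : Type*} [Group G] (Γ : Set G) : Prop :=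
  ∃ d C : ℕ, ∀ g h : G, ¬ IsOfFinOrder g → ¬ IsOfFinOrder h → CommensurableElements g h →
    ∃ s t : ℤ, s ≠ 0 ∧ t ≠ 0 ∧ g ^ s = h ^ t ∧
      s.natAbs ≤ C * (wordLength Γ g + wordLength Γ h) ^ d ∧
      t.natAbs ≤ C * (wordLength Γ g + wordLength Γ h) ^ d

/-- A group is c-tame if it is finitely generated and tame with respect to commensurability
over each of its finite symmetric generating sets. -/
def IsCTame (G : Type*) [Group G] : Prop :=
  Group.FG G ∧ ∀ Γ : Set G, IsFiniteSymmGenSet Γ → IsCTameWith Γ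

/-- The restricted wreath product of `A` by `H`, as the subgroup of the unrestricted one (pairs
`(f, h)` with `(f₁, h₁) (f₂, h₂) = (a ↦ f₁ a * f₂ (h₁⁻¹ * a), h₁ * h₂)`) that consists of the
pairs `(f, h)` such that `f : H → A` has finite support. -/
def restrictedWreath (A H : Type*) [Group A] [Group H] : Subgroup (A ≀ᵣ H) where
  carrier := {x | (Function.mulSupport x.left).Finite}
  one_mem' := by simp
  mul_mem' := by
    intro x y hx hy
    have hy' : (Function.mulSupport fun a : H ↦ y.left (x.right⁻¹ * a)).Finite :=
      hy.preimage (mul_right_injective x.right⁻¹).injOn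
    exact (hx.union hy').subset
      (Function.mulSupport_mul x.left fun a : H ↦ y.left (x.right⁻¹ * a))
  inv_mem' := by
    intro x hx
    have hx' : (Function.mulSupport fun a : H ↦ x.left (x.right * a)).Finite :=
      hx.preimage (mul_right_injective x.right).injOn
    refine hx'.subset fun a ha ↦ ?_
    simpa using ha

/-- The free abelian group `ℤ ^ r`, written multiplicatively. -/
abbrev FreeAb (r : ℕ) : Type := Multiplicative (Fin r → ℤ)

/-- The iterated wreath products `W 0 r = ℤ ^ r` and `W (m + 1) r = ℤ ^ r ≀ W m r`
(restricted). -/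
def W : ℕ → ℕ → GrpCat.{0}
  | 0, r => GrpCat.of (FreeAb r)
  | m + 1, r => GrpCat.of (restrictedWreath (FreeAb r) (W m r))

/-- The free solvable group of derived length `m` and rank `r`: the quotient of the free group of
rank `r` by the `m`-th term of its derived series. -/
abbrev S (m r : ℕ) : Type := FreeGroup (Fin r) ⧸ derivedSeries (FreeGroup (Fin r)) m

end CTameness

namespace CTameness

open RegularWreathProduct

/-! The induction carries two properties: word-tameness and uniqueness of roots
(`IsMulTorsionFree`). Both pass from `H` to the wreath product of `ℤ ^ r` with `H`. Let `g ^ x = h ^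
y`. If the projections to `H` are trivial, `g` and `h` are proportional functions, and a coordinate
of each, at a common place, serves as the exponent of the other; coordinates grow at most linearly
in word length. Otherwise exponents `s, t` that work in `H` satisfy `x * t = s * y`, so `g ^ s` and
`h ^ t` have equal `y`-th powers and coincide by uniqueness of roots (`WordTame.restrictedWreath`).
This settles `W`. Both properties pass to subgroups, so `S` follows from the Magnus embedding of `F
/ [N, N]` into the wreath product of `ℤ ^ r` with `F / N`. -/

/-- A form of c-tameness that passes to subgroups: the exponents are bounded in terms of the lengths
of words over an arbitrary finite subset of the group. -/
def WordTame (G : Type*) [Group G] : Prop :=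
  ∀ Γ : Set G, Γ.Finite → ∃ d C : ℕ, ∀ u v : List G, (∀ a ∈ u, a ∈ Γ) → (∀ a ∈ v, a ∈ Γ) →
    ¬ IsOfFinOrder u.prod → ¬ IsOfFinOrder v.prod → CommensurableElements u.prod v.prod →
    ∃ s t : ℤ, s ≠ 0 ∧ t ≠ 0 ∧ u.prod ^ s = v.prod ^ t ∧
      s.natAbs ≤ C * (u.length + v.length) ^ d ∧ t.natAbs ≤ C * (u.length + v.length) ^ d

/-! ### Word-tameness and its inheritance by subgroups -/

section WordTame

variable {G H : Type*} [Group G] [Group H]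

theorem exists_word_length_eq_wordLength {Γ : Set G} (hΓ : IsFiniteSymmGenSet Γ) (g : G) :
    ∃ w : List G, (∀ a ∈ w, a ∈ Γ) ∧ w.prod = g ∧ w.length = wordLength Γ g := by
  obtain ⟨w, hw, hg⟩ := hΓ.generates g
  exact Nat.sInf_mem (s := {n : ℕ | ∃ w : List G, (∀ a ∈ w, a ∈ Γ) ∧ w.prod = g ∧ w.length = n})
    ⟨_, w, hw, hg, rfl⟩

theorem WordTame.isCTame (h : WordTame G) (hG : Group.FG G) : IsCTame G := by
  refine ⟨hG, fun Γ hΓ ↦ ?_⟩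
  obtain ⟨d, C, hC⟩ := h Γ hΓ.finite
  refine ⟨d, C, fun x y hx hy hxy ↦ ?_⟩
  obtain ⟨u, hu, rfl, hul⟩ := exists_word_length_eq_wordLength hΓ x
  obtain ⟨v, hv, rfl, hvl⟩ := exists_word_length_eq_wordLength hΓ y
  rw [← hul, ← hvl]
  exact hC u v hu hv hx hy hxy

/-- Words over `Γ` map to words of the same length over `f '' Γ`, which is finite but need not
generate `H`; hence the arbitrary finite sets in `WordTame`. -/
theorem WordTame.of_injective (h : WordTame H) (f : G →* H) (hf : Function.Injective f) :
    WordTame G := by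
  intro Γ hΓ
  obtain ⟨d, C, hC⟩ := h (f '' Γ) (hΓ.image f)
  refine ⟨d, C, fun u v hu hv hu' hv' huv ↦ ?_⟩
  obtain ⟨s, t, hs, ht, hst, hsb, htb⟩ := hC (u.map f) (v.map f)
    (by simpa using fun a ha ↦ ⟨a, hu a ha, rfl⟩) (by simpa using fun a ha ↦ ⟨a, hv a ha, rfl⟩)
    (by rwa [← map_list_prod, hf.isOfFinOrder_iff])
    (by rwa [← map_list_prod, hf.isOfFinOrder_iff])
    (by
      obtain ⟨x, y, hx, hy, hxy⟩ := huv
      exact ⟨x, y, hx, hy, by rw [← map_list_prod, ← map_list_prod, ← map_zpow, ← map_zpow, hxy]⟩)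
  refine ⟨s, t, hs, ht, hf ?_, by simpa using hsb, by simpa using htb⟩
  simpa [map_list_prod] using hst

theorem WordTame.of_subsingleton [Subsingleton G] : WordTame G :=
  fun _ _ ↦ ⟨0, 0, fun u _ _ _ hu ↦ absurd (Subsingleton.elim u.prod 1 ▸ IsOfFinOrder.one) hu⟩

end WordTame

/-! ### Restricted wreath products -/

section Wreath

variable {A H : Type*} [CommGroup A] [Group H]

/-- The inclusion of the base group of the unrestricted wreath product. -/
def base (A H : Type*) [CommGroup A] [Group H] : (H → A) →* A ≀ᵣ H where
  toFun f := ⟨f, 1⟩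
  map_one' := rfl
  map_mul' _ _ := by ext <;> simp

@[simp]
theorem base_left (f : H → A) : (base A H f).left = f := rfl

@[simp]
theorem base_right (f : H → A) : (base A H f).right = 1 := rfl

theorem base_injective : Function.Injective (base A H) :=
  fun _ _ h ↦ congrArg RegularWreathProduct.left h

theorem base_left_of_right_eq_one {x : A ≀ᵣ H} (hx : x.right = 1) : base A H x.left = x := by
  ext <;> simp [hx]

theorem right_zpow (x : A ≀ᵣ H) (n : ℤ) : (x ^ n).right = x.right ^ n :=
  map_zpow (rightHom : A ≀ᵣ H →* H) x n

theorem right_pow (x : A ≀ᵣ H) (n : ℕ) : (x ^ n).right = x.right ^ n :=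
  map_pow (rightHom : A ≀ᵣ H →* H) x n

/-- The projection of the restricted wreath product onto the acting group. -/
def restrictedRightHom (A H : Type*) [CommGroup A] [Group H] : restrictedWreath A H →* H :=
  rightHom.comp (restrictedWreath A H).subtype

@[simp]
theorem restrictedRightHom_apply (x : restrictedWreath A H) :
    restrictedRightHom A H x = x.1.right := rfl

/-- A nontrivial value would be repeated along the infinite orbit of `p` under the powers of `d`. -/
theorem eq_one_of_translation_invariant [IsMulTorsionFree H] {f : H → A} {d : H} (hd : d ≠ 1)
    (hf : (Function.mulSupport f).Finite) (h : ∀ p, f (d * p) = f p) : f = 1 := by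
  by_contra hne
  obtain ⟨p, hp⟩ := Function.ne_iff.mp hne
  have hpow : ∀ n : ℕ, f (d ^ n * p) = f p := by
    intro n
    induction n with
    | zero => simp
    | succ n ih => rw [pow_succ', mul_assoc, h, ih]
  refine Set.infinite_of_injective_forall_mem (f := fun n : ℕ ↦ d ^ n * p) (fun a b hab ↦ ?_)
    (fun n ↦ ?_) hf
  · exact injective_pow_iff_not_isOfFinOrder.mpr (not_isOfFinOrder_of_isMulTorsionFree hd)
      (mul_right_cancel hab)
  · simpa [Function.mem_mulSupport, hpow] using hp

/-- If `x ^ n = y ^ n`, the quotient `x * y⁻¹` lies in the base group. When the common projection is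
nontrivial, `x * y⁻¹` commutes with `y ^ n`, so its function is invariant under a nontrivial
translation and vanishes. Otherwise roots are compared pointwise in `A`. -/
instance [IsMulTorsionFree A] [IsMulTorsionFree H] :
    IsMulTorsionFree (restrictedWreath A H) where
  pow_left_injective n hn := by
    rintro ⟨x, hx⟩ ⟨y, hy⟩ hxy
    replace hxy : x ^ n = y ^ n := congrArg Subtype.val hxy
    have hr : x.right = y.right := by
      apply pow_left_injective hn
      simpa [right_pow] using congrArg RegularWreathProduct.right hxy
    rw [Subtype.mk.injEq]
    by_cases hc : y.right = 1
    · rw [← base_left_of_right_eq_one hc, ← base_left_of_right_eq_one (hr.trans hc), ← map_pow,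
        ← map_pow] at hxy
      rw [← base_left_of_right_eq_one hc, ← base_left_of_right_eq_one (hr.trans hc)]
      exact congrArg _ (pow_left_injective hn (base_injective hxy))
    · have hcomm : Commute (y ^ n) (x * y⁻¹) :=
        (hxy ▸ (Commute.refl x).pow_left n).mul_right ((Commute.refl y).pow_left n).inv_right
      have hk : (x * y⁻¹).right = 1 := by simp [hr]
      have hfin : (Function.mulSupport (x * y⁻¹).left).Finite :=
        (restrictedWreath A H).mul_mem hx ((restrictedWreath A H).inv_mem hy)
      have hone : (x * y⁻¹).left = 1 := by
        refine eq_one_of_translation_invariant (d := (y.right ^ n)⁻¹) (by simp [hc, hn]) hfin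
          fun p ↦ ?_
        have := congrFun (congrArg RegularWreathProduct.left hcomm.eq) p
        rw [mul_left (y ^ n), mul_left (x * y⁻¹), hk, Pi.mul_apply, Pi.mul_apply, inv_one, one_mul, right_pow,
          mul_comm] at this
        exact mul_right_cancel this
      rw [← mul_inv_eq_one, ← base_left_of_right_eq_one hk, hone, map_one]

theorem base_mem_closure {M : Subgroup (A ≀ᵣ H)} [DecidableEq H]
    (hb : ∀ a, base A H (Pi.mulSingle 1 a) ∈ M) (hi : ∀ h, inl h ∈ M) (s : Finset H) :
    ∀ f : H → A, Function.mulSupport f ⊆ s → base A H f ∈ M := by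
  induction s using Finset.induction_on with
  | empty =>
    intro f hf
    have : f = 1 := by simpa using hf
    rw [this, map_one]
    exact M.one_mem
  | insert a s has ih =>
    intro f hf
    have hfa : f = Pi.mulSingle a (f a) * Function.update f a 1 := by
      ext p
      by_cases hp : p = a
      · subst hp; simp
      · simp [hp]
    have hsingle : base A H (Pi.mulSingle a (f a)) =
        inl a * base A H (Pi.mulSingle 1 (f a)) * (inl a)⁻¹ := by
      ext p
      · by_cases hp : p = a
        · subst hp; simp
        · have : a⁻¹ * p ≠ 1 := fun h ↦ hp (inv_mul_eq_one.mp h).symm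
          simp [hp, this]
      · simp
    rw [hfa, map_mul, hsingle]
    refine M.mul_mem (M.mul_mem (M.mul_mem (hi a) (hb _)) (M.inv_mem (hi a))) (ih _ fun p hp ↦ ?_)
    by_cases hpa : p = a
    · subst hpa; simp at hp
    · have : p ∈ Function.mulSupport f := by simpa [hpa] using hp
      simpa [hpa] using hf this

theorem fg_restrictedWreath [Group.FG A] [Group.FG H] : Group.FG (restrictedWreath A H) := by
  classical
  rw [Group.fg_iff_subgroup_fg]
  have hEq : restrictedWreath A H =
      ((base A H).comp (MonoidHom.mulSingle (fun _ : H ↦ A) 1)).range ⊔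
        (inl : H →* A ≀ᵣ H).range := by
    apply le_antisymm
    · intro x hx
      have hfin : (Function.mulSupport x.left).Finite := hx
      have hx' : x = base A H x.left * inl x.right := by ext <;> simp
      rw [hx']
      refine mul_mem (base_mem_closure (fun a ↦ ?_) (fun h ↦ ?_) hfin.toFinset _ ?_) ?_
      · exact Subgroup.mem_sup_left ⟨a, rfl⟩
      · exact Subgroup.mem_sup_right ⟨h, rfl⟩
      · exact hfin.coe_toFinset.ge
      · exact Subgroup.mem_sup_right ⟨_, rfl⟩
    · refine sup_le ?_ ?_
      · rintro _ ⟨a, rfl⟩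
        exact (Set.finite_singleton 1).subset Pi.mulSupport_mulSingle_subset
      · rintro _ ⟨h, rfl⟩
        change (Function.mulSupport (1 : H → A)).Finite
        simp
  rw [hEq]
  exact ((Group.fg_iff_subgroup_fg _).mp inferInstance).sup
    ((Group.fg_iff_subgroup_fg _).mp inferInstance)

/-- Each letter adds a translated function, whose coordinates are bounded over the finitely many
letters and their finite supports. -/
theorem exists_coordinate_bound {r : ℕ} {Γ : Set (restrictedWreath (FreeAb r) H)}
    (hΓ : Γ.Finite) : ∃ K : ℕ, ∀ w : List (restrictedWreath (FreeAb r) H), (∀ a ∈ w, a ∈ Γ) →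
      ∀ p i, ((w.prod.1.left p).toAdd i).natAbs ≤ K * w.length := by
  have hfin : (⋃ x ∈ Γ, ⋃ i, (fun p ↦ ((x.1.left p).toAdd i).natAbs) ''
      Function.mulSupport x.1.left).Finite :=
    hΓ.biUnion fun x _ ↦ Set.finite_iUnion fun i ↦ Set.Finite.image _ x.2
  obtain ⟨K, hK⟩ := hfin.bddAbove
  have hK' : ∀ x ∈ Γ, ∀ p i, ((x.1.left p).toAdd i).natAbs ≤ K := by
    intro x hx p i
    by_cases hp : x.1.left p = 1
    · simp [hp]
    · exact hK (Set.mem_biUnion hx (Set.mem_iUnion.mpr ⟨i, p, hp, rfl⟩))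
  refine ⟨K, fun w ↦ ?_⟩
  induction w with
  | nil => simp
  | cons x w ih =>
    intro hw p i
    have h1 := hK' x (hw x (by simp)) p i
    have h2 := ih (fun a ha ↦ hw a (by simp [ha])) (x.1.right⁻¹ * p) i
    have h3 := Int.natAbs_add_le ((x.1.left p).toAdd i)
      ((w.prod.1.left (x.1.right⁻¹ * p)).toAdd i)
    simp only [List.prod_cons, Subgroup.coe_mul, mul_left, Pi.mul_apply, toAdd_mul, Pi.add_apply,
      List.length_cons]
    linarith

/-- Proportional elements of the base group have powers that agree, with exponents among the
coordinates of the two elements. -/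
theorem exists_coordinate_zpow_eq {X : Type*} {r : ℕ} {f f' : X → FreeAb r} {x y : ℤ} (hx : x ≠ 0)
    (hf : f ≠ 1) (h : f ^ x = f' ^ y) : ∃ p i, (f' p).toAdd i ≠ 0 ∧ (f p).toAdd i ≠ 0 ∧
      f ^ (f' p).toAdd i = f' ^ (f p).toAdd i := by
  have hc : ∀ p i, x * (f p).toAdd i = y * (f' p).toAdd i := fun p i ↦ by
    simpa using congrFun (congrArg Multiplicative.toAdd (congrFun h p)) i
  obtain ⟨p, hp⟩ := Function.ne_iff.mp hf
  obtain ⟨i, hi⟩ := Function.ne_iff.mp (show (f p).toAdd ≠ 0 from hp)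
  replace hi : (f p).toAdd i ≠ 0 := hi
  refine ⟨p, i, fun h0 ↦ ?_, hi, ?_⟩
  · have := hc p i
    simp [h0, hx, hi] at this
  · funext q
    apply Multiplicative.toAdd.injective
    funext j
    simp only [Pi.pow_apply, toAdd_zpow, Pi.smul_apply, smul_eq_mul]
    have h1 := hc p i
    have h2 := hc q j
    have hy : y ≠ 0 := by
      rintro rfl
      simp [hx, hi] at h1
    apply mul_left_cancel₀ (mul_ne_zero hx hy)
    linear_combination (y * (f' p).toAdd i) * h2 - (y * (f' q).toAdd j) * h1

theorem WordTame.restrictedWreath {r : ℕ} [IsMulTorsionFree H] (hH : WordTame H) :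
    WordTame (restrictedWreath (FreeAb r) H) := by
  intro Γ hΓ
  obtain ⟨d, C, hC⟩ := hH (restrictedRightHom _ H '' Γ) (hΓ.image _)
  obtain ⟨K, hK⟩ := exists_coordinate_bound hΓ
  -- These constants dominate both `C * n ^ d` (nontrivial projections) and `K * n` (base group), as
  -- the total length `n` is at least 1.
  refine ⟨d + 1, C + K, fun u v hu hv hu' hv' ⟨x, y, hx, hy, hxy⟩ ↦ ?_⟩
  have hn : 1 ≤ u.length + v.length := by
    rcases u with _ | ⟨a, u⟩
    · exact absurd (by simp) hu'
    · simp; omega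
  have hdn := Nat.one_le_pow d _ hn
  have hbC : C * (u.length + v.length) ^ d ≤ (C + K) * (u.length + v.length) ^ (d + 1) :=
    Nat.mul_le_mul (by omega) (Nat.pow_le_pow_right hn (by omega))
  have hbK : K * (u.length + v.length) ≤ (C + K) * (u.length + v.length) ^ (d + 1) := by
    refine Nat.mul_le_mul (by omega) ?_
    rw [pow_succ]
    exact Nat.le_mul_of_pos_left _ hdn
  have hbar : u.prod.1.right ^ x = v.prod.1.right ^ y := by
    rw [← right_zpow, ← right_zpow]
    exact congrArg (restrictedRightHom _ H) hxy
  by_cases hr : u.prod.1.right = 1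
  · have hr' : v.prod.1.right = 1 := by
      rw [hr, one_zpow, eq_comm, IsMulTorsionFree.zpow_eq_one_iff_left hy] at hbar
      exact hbar
    have eu := base_left_of_right_eq_one hr
    have ev := base_left_of_right_eq_one hr'
    have hbase : u.prod.1.left ^ x = v.prod.1.left ^ y := by
      apply base_injective
      rw [map_zpow, map_zpow, eu, ev]
      simpa using congrArg Subtype.val hxy
    obtain ⟨p, i, h1, h2, h3⟩ := exists_coordinate_zpow_eq hx (fun h ↦ hu' (by
      have : u.prod = 1 := Subtype.ext (by rw [← eu, h, map_one]; rfl)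
      rw [this]
      exact IsOfFinOrder.one)) hbase
    refine ⟨_, _, h1, h2, Subtype.ext ?_, ?_, ?_⟩
    · rw [Subgroup.coe_zpow, Subgroup.coe_zpow, ← eu, ← ev, ← map_zpow, ← map_zpow]
      exact congrArg _ h3
    · exact ((hK v hv p i).trans (Nat.mul_le_mul_left _ (by omega))).trans hbK
    · exact ((hK u hu p i).trans (Nat.mul_le_mul_left _ (by omega))).trans hbK
  · have hr' : v.prod.1.right ≠ 1 := fun h ↦ hr (by
      rw [h, one_zpow, IsMulTorsionFree.zpow_eq_one_iff_left hx] at hbar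
      exact hbar)
    have hpu : (u.map (restrictedRightHom _ H)).prod = u.prod.1.right :=
      (map_list_prod (restrictedRightHom _ H) u).symm
    have hpv : (v.map (restrictedRightHom _ H)).prod = v.prod.1.right :=
      (map_list_prod (restrictedRightHom _ H) v).symm
    obtain ⟨s, t, hs, ht, hst, hsb, htb⟩ := hC (u.map (restrictedRightHom _ H))
      (v.map (restrictedRightHom _ H))
      (fun b hb ↦ by
        obtain ⟨a, ha, rfl⟩ := List.mem_map.mp hb
        exact ⟨a, hu a ha, rfl⟩)
      (fun b hb ↦ by
        obtain ⟨a, ha, rfl⟩ := List.mem_map.mp hb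
        exact ⟨a, hv a ha, rfl⟩)
      (by rw [hpu]; exact not_isOfFinOrder_of_isMulTorsionFree hr)
      (by rw [hpv]; exact not_isOfFinOrder_of_isMulTorsionFree hr')
      (by rw [hpu, hpv]; exact ⟨x, y, hx, hy, hbar⟩)
    rw [hpu, hpv] at hst
    rw [List.length_map, List.length_map] at hsb htb
    -- The projection of `u.prod` has infinite order, so its exponents can be compared.
    have hcross : x * t = s * y := by
      refine injective_zpow_iff_not_isOfFinOrder.mpr (not_isOfFinOrder_of_isMulTorsionFree hr) ?_
      change u.prod.1.right ^ (x * t) = u.prod.1.right ^ (s * y)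
      rw [zpow_mul, hbar, zpow_mul, hst, ← zpow_mul, ← zpow_mul, mul_comm]
    refine ⟨s, t, hs, ht, zpow_left_injective hy ?_, hsb.trans hbC, htb.trans hbC⟩
    change (u.prod ^ s) ^ y = (v.prod ^ t) ^ y
    rw [← zpow_mul, ← hcross, zpow_mul, hxy, ← zpow_mul, ← zpow_mul, mul_comm]

end Wreath

/-! ### The Magnus embedding -/

section Magnus

variable {r : ℕ} (N : Subgroup (FreeGroup (Fin r))) [N.Normal]

/-- The Magnus homomorphism from the free group to the wreath product of `ℤ ^ r` with `F / N`. -/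
noncomputable def magnus :
    FreeGroup (Fin r) →* restrictedWreath (FreeAb r) (FreeGroup (Fin r) ⧸ N) := by
  classical
  exact FreeGroup.lift fun i ↦
    ⟨⟨Pi.mulSingle 1 (Multiplicative.ofAdd (Pi.single i 1)), (FreeGroup.of i : FreeGroup (Fin r))⟩,
      (Set.finite_singleton 1).subset Pi.mulSupport_mulSingle_subset⟩

theorem magnus_right (w : FreeGroup (Fin r)) :
    (magnus N w).1.right = (w : FreeGroup (Fin r) ⧸ N) := by
  have : (restrictedRightHom _ _).comp (magnus N) = QuotientGroup.mk' N := by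
    ext i
    simp [magnus]
  exact DFunLike.congr_fun this w

open Classical in
theorem magnus_mul_of_left (w : FreeGroup (Fin r)) (i : Fin r) :
    (magnus N (w * FreeGroup.of i)).1.left = (magnus N w).1.left *
      Pi.mulSingle (w : FreeGroup (Fin r) ⧸ N) (Multiplicative.ofAdd (Pi.single i 1)) := by
  have hi : (magnus N (FreeGroup.of i)).1.left =
      (Pi.mulSingle 1 (Multiplicative.ofAdd (Pi.single i 1)) :
        FreeGroup (Fin r) ⧸ N → FreeAb r) := by
    simp [magnus]
  rw [map_mul, Subgroup.coe_mul, mul_left, hi, magnus_right]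
  congr 1
  funext p
  by_cases hp : p = (w : FreeGroup (Fin r) ⧸ N)
  · subst hp
    simp
  · have : (w : FreeGroup (Fin r) ⧸ N)⁻¹ * p ≠ 1 := fun h ↦ hp (inv_mul_eq_one.mp h).symm
    rw [Pi.mulSingle_eq_of_ne this, Pi.mulSingle_eq_of_ne hp]

/-- The element of `N` by which `w` differs from the chosen representative of its class. -/
noncomputable def defect (w : FreeGroup (Fin r)) : N :=
  ⟨w * (w : FreeGroup (Fin r) ⧸ N).out⁻¹, by
    rw [← QuotientGroup.eq_one_iff, QuotientGroup.mk_mul, QuotientGroup.mk_inv,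
      QuotientGroup.out_eq', mul_inv_cancel]⟩

/-- The map to the abelianization of `N`, multiplicative on finitely supported functions, that sends
each edge of the Cayley graph of
`F / N` to the class of the corresponding Schreier generator. -/
noncomputable def flowClass (f : FreeGroup (Fin r) ⧸ N → FreeAb r) : Abelianization N :=
  ∏ᶠ q, ∏ i, Abelianization.of (defect N (q.out * FreeGroup.of i)) ^ (f q).toAdd i

theorem flowClass_mulSupport_finite {f : FreeGroup (Fin r) ⧸ N → FreeAb r}
    (hf : (Function.mulSupport f).Finite) : (Function.mulSupport fun q ↦
      ∏ i, Abelianization.of (defect N (q.out * FreeGroup.of i)) ^ (f q).toAdd i).Finite := by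
  refine hf.subset fun q hq hq' ↦ hq ?_
  simp [hq']

theorem flowClass_mul {f g : FreeGroup (Fin r) ⧸ N → FreeAb r}
    (hf : (Function.mulSupport f).Finite) (hg : (Function.mulSupport g).Finite) :
    flowClass N (f * g) = flowClass N f * flowClass N g := by
  rw [flowClass, flowClass, flowClass, ← finprod_mul_distrib (flowClass_mulSupport_finite N hf)
    (flowClass_mulSupport_finite N hg)]
  simp [zpow_add, Finset.prod_mul_distrib]

open Classical in
theorem flowClass_mulSingle (q : FreeGroup (Fin r) ⧸ N) (i : Fin r) :
    flowClass N (Pi.mulSingle q (Multiplicative.ofAdd (Pi.single i 1))) =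
      Abelianization.of (defect N (q.out * FreeGroup.of i)) := by
  rw [flowClass, finprod_eq_single _ q]
  · rw [Finset.prod_eq_single i] <;> simp +contextual
  · intro p hp
    simp [hp]

/-- Schreier rewriting: the inserted representative of the class of `w` cancels. -/
theorem defect_mul_of (w : FreeGroup (Fin r)) (i : Fin r) :
    defect N (w * FreeGroup.of i) = defect N w *
      defect N ((w : FreeGroup (Fin r) ⧸ N).out * FreeGroup.of i) := by
  apply Subtype.ext
  simp only [defect, Subgroup.coe_mul, QuotientGroup.mk_mul, QuotientGroup.out_eq']
  group

/-- The class of the defect of `w`, corrected by the flow of `w`; it does not depend on `w`. -/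
noncomputable def flowDefect (w : FreeGroup (Fin r)) : Abelianization N :=
  Abelianization.of (defect N w) * (flowClass N (magnus N w).1.left)⁻¹

/-- Appending a generator multiplies the class of the defect and the class of the flow by the same
Schreier generator. -/
theorem flowDefect_mul (w u : FreeGroup (Fin r)) : flowDefect N (w * u) = flowDefect N w := by
  classical
  have hof : ∀ w i, flowDefect N (w * FreeGroup.of i) = flowDefect N w := by
    intro w i
    rw [flowDefect, flowDefect, magnus_mul_of_left, defect_mul_of, map_mul,
      flowClass_mul N (magnus N w).2
        ((Set.finite_singleton _).subset Pi.mulSupport_mulSingle_subset), flowClass_mulSingle,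
      mul_inv, mul_mul_mul_comm, mul_inv_cancel, mul_one]
  induction u using FreeGroup.induction_on generalizing w with
  | C1 => rw [mul_one]
  | of i => exact hof w i
  -- An inverse letter is the generator step read backwards.
  | inv_of i _ => rw [← hof (w * _) i, inv_mul_cancel_right]
  | mul u v hu hv => rw [← mul_assoc, hv, hu]

theorem mem_commutator_of_magnus_eq_one {w : FreeGroup (Fin r)} (hw : magnus N w = 1) :
    w ∈ ⁅N, N⁆ := by
  have hq : (w : FreeGroup (Fin r) ⧸ N) = 1 := by rw [← magnus_right, hw]; rfl
  have hN : w ∈ N := (QuotientGroup.eq_one_iff w).mp hq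
  have hD : flowDefect N w = flowDefect N 1 := by rw [← flowDefect_mul N 1 w, one_mul]
  -- The chosen representative of the trivial class need not be 1, so `defect N 1` stays and cancels
  -- in the comparison with `flowDefect N 1`.
  have hd : defect N w = ⟨w, hN⟩ * defect N 1 := by
    apply Subtype.ext
    simp [defect, hq]
  have hof : Abelianization.of (⟨w, hN⟩ : N) = 1 := by
    rwa [flowDefect, flowDefect, hw, map_one, mul_left_inj, hd, map_mul, mul_eq_right] at hD
  rw [← N.map_subtype_commutator]
  exact ⟨⟨w, hN⟩, (QuotientGroup.eq_one_iff _).mp hof, rfl⟩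

/-- `N` lands in the base group, which is abelian. -/
theorem commutator_le_ker_magnus : ⁅N, N⁆ ≤ (magnus N).ker := by
  refine Subgroup.commutator_le.mpr fun g hg h hh ↦ ?_
  have key : ∀ g ∈ N, base _ _ (magnus N g).1.left = (magnus N g).1 := fun g hg ↦
    base_left_of_right_eq_one (by rw [magnus_right]; exact (QuotientGroup.eq_one_iff g).mpr hg)
  rw [MonoidHom.mem_ker, map_commutatorElement, commutatorElement_eq_one_iff_mul_comm]
  apply Subtype.ext
  rw [Subgroup.coe_mul, Subgroup.coe_mul, ← key g hg, ← key h hh, ← map_mul, mul_comm, map_mul]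

/-- The Magnus embedding of `F / [N, N]` into the wreath product of `ℤ ^ r` with `F / N`. -/
noncomputable def magnusEmbedding :
    FreeGroup (Fin r) ⧸ ⁅N, N⁆ →* restrictedWreath (FreeAb r) (FreeGroup (Fin r) ⧸ N) :=
  QuotientGroup.lift _ (magnus N) (commutator_le_ker_magnus N)

theorem magnusEmbedding_injective : Function.Injective (magnusEmbedding N) := by
  rw [injective_iff_map_eq_one]
  intro x
  induction x using QuotientGroup.induction_on with
  | H w => exact fun hw ↦ (QuotientGroup.eq_one_iff w).mpr (mem_commutator_of_magnus_eq_one N hw)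

end Magnus

/-! ### Induction on the derived length -/

theorem isMulTorsionFree_wordTame_freeAb (r : ℕ) :
    IsMulTorsionFree (FreeAb r) ∧ WordTame (FreeAb r) := by
  refine ⟨inferInstance, ?_⟩
  -- `ℤ ^ r` is the base group of its wreath product with the trivial group.
  refine (WordTame.restrictedWreath (r := r) (WordTame.of_subsingleton (G := Unit))).of_injective
    (((base (FreeAb r) Unit).comp (Pi.constMonoidHom Unit (FreeAb r))).codRestrict _ fun _ ↦
      Set.toFinite _) fun a b hab ↦ ?_
  exact congrFun (base_injective (congrArg Subtype.val hab)) ()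

theorem W_fg_torsionFree_wordTame (m r : ℕ) :
    Group.FG (W m r) ∧ IsMulTorsionFree (W m r) ∧ WordTame (W m r) := by
  induction m with
  | zero => exact ⟨inferInstanceAs (Group.FG (FreeAb r)), isMulTorsionFree_wordTame_freeAb r⟩
  | succ m ih =>
    obtain ⟨_, _, h⟩ := ih
    exact ⟨fg_restrictedWreath (A := FreeAb r) (H := W m r),
      inferInstanceAs (IsMulTorsionFree (restrictedWreath (FreeAb r) (W m r))), h.restrictedWreath⟩

theorem S_torsionFree_wordTame (m r : ℕ) : IsMulTorsionFree (S m r) ∧ WordTame (S m r) := by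
  induction m with
  | zero =>
    have : Subsingleton (S 0 r) := QuotientGroup.subsingleton_quotient_top
    exact ⟨inferInstance, WordTame.of_subsingleton⟩
  | succ m ih =>
    obtain ⟨_, h⟩ := ih
    -- By definition `S (m + 1) r` is `F / [N, N]` with `N` the `m`-th derived subgroup.
    have hinj := magnusEmbedding_injective (derivedSeries (FreeGroup (Fin r)) m)
    exact ⟨hinj.isMulTorsionFree _, h.restrictedWreath.of_injective _ hinj⟩

end CTameness

theorem mainTheorem11 (m r : ℕ) (hr : 1 ≤ r) :
    CTameness.IsCTame (CTameness.W m r) ∧ CTameness.IsCTame (CTameness.S m r) := by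
  obtain ⟨hW, _, hW'⟩ := CTameness.W_fg_torsionFree_wordTame m r
  exact ⟨hW'.isCTame hW, (CTameness.S_torsionFree_wordTame m r).2.isCTame inferInstance⟩
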